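/- Let $E$ be a countable set and let $(P_t)_{t\ge 0}$, $P_t=(P_t(i,j))_{i,j\in E}$, be the transition semigroup of a continuous-time Markov chain on $E$ with totally stable and conservative $Q$-matrix $Q=(q_{ij})$: the $P_t$ are stochastic matrices with $P_0=I$ and $P_{s+t}=P_sP_t$, the $q_{ij}$ are real with $q_{ij}\ge 0$ for $i\ne j$ and $\sum_j q_{ij}=0$, and $q_{ij}=\lim_{t\downarrow 0}(P_t(i,j)-P_0(i,j))/t$. Let $\pi$ be a stationary probability distribution ($\pi P_t=\pi$ for all $t\ge0$) with $\pi_i>0$ for all $i\in E$. The chain need not be reversible with respect to $\pi$. Define $$\mathrm{gap}(Q)=\inf\{(-Qg,g)_{L^2(\pi)}:\ g\in\mathcal D,\ \pi(g)=0,\ \|g\|_{L^2(\pi)}=1\}$$ (with $\inf\emptyset=+\infty$), where $(Qg)(i)=\sum_j q_{ij}g(j)$ and $\mathcal D$ is the domain of the generator of $(P_t)$ in $L^2(\pi)$, i.e. the set of real $g\in L^2(\pi)$ for which $(P_tg-g)/t$ converges in $L^2(\pi)$ as $t\downarrow0$. For $f:E\to[1,\infty)$ and a signed measure $\mu$ on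 $E$ put $\|\mu\|_f=\sup_{|g|\le f}|\mu(g)|$. The semigroup is exponentially $f$-ergodic if there are $\varepsilon>0$ and constants $C(i,f)\in(0,\infty)$, $i\in E$, such that $$\|P_t(i,\cdot)-\pi\|_f\le C(i,f)\,e^{-\varepsilon t}\qquad\text{for all } i\in E,\ t\ge 0,$$ and $\varepsilon_{\max}$ denotes the supremum of all such $\varepsilon$. Proposition. Let $f:E\to[1,\infty)$ satisfy $\pi(f^2)<\infty$. If $\mathrm{gap}(Q)>0$, then $(P_t)$ is exponentially $f$-ergodic, $\varepsilon_{\max}\ge \mathrm{gap}(Q)$, and for every real $\varepsilon\le\mathrm{gap}(Q)$ (in particular for $\varepsilon=\mathrm{gap}(Q)$ when this is finite) $$\|P_t(i,\cdot)-\pi\|_f\le \pi(f^2)^{1/2}\left(\frac1{\pi_i}-1\right)^{1/2}e^{-\varepsilon t}\qquad\text{for all } i\in E,\ t\ge0 .$$ -/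

import Mathlib

open Filter Topology

/-- A totally stable (all entries are real numbers) and conservative `Q`-matrix on `E`:
nonnegative off-diagonal entries and rows that sum to zero. -/
structure IsQMatrix {E : Type*} (Q : E → E → ℝ) : Prop where
  offDiag_nonneg : ∀ i j, i ≠ j → 0 ≤ Q i j
  row_sum : ∀ i, HasSum (fun j => Q i j) 0

/-- `P t i j`, `t ≥ 0`, is the transition function (Markov semigroup) of a continuous-time Markov
chain on `E` with `Q`-matrix `Q`. Values of `P` at negative times are irrelevant. -/
structure IsMarkovSemigroup {E : Type*} (Q : E → E → ℝ) (P : ℝ → E → E → ℝ) : Prop where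
  nonneg : ∀ t, 0 ≤ t → ∀ i j, 0 ≤ P t i j
  row_sum : ∀ t, 0 ≤ t → ∀ i, HasSum (fun j => P t i j) 1
  zero_diag : ∀ i, P 0 i i = 1
  zero_offDiag : ∀ i j, i ≠ j → P 0 i j = 0
  chapman_kolmogorov : ∀ s t, 0 ≤ s → 0 ≤ t → ∀ i j,
    HasSum (fun k => P s i k * P t k j) (P (s + t) i j)
  /-- The `Q`-matrix is the right derivative at time `0`. -/
  deriv_zero : ∀ i j, HasDerivWithinAt (fun t => P t i j) (Q i j) (Set.Ici 0) 0

/-- `π` is a stationary probability distribution of `P` that charges every state. -/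
structure IsStationaryDistribution {E : Type*} (P : ℝ → E → E → ℝ) (π : E → ℝ) : Prop where
  pos : ∀ i, 0 < π i
  sum_one : HasSum π 1
  stationary : ∀ t, 0 ≤ t → ∀ j, HasSum (fun i => π i * P t i j) (π j)

/-- The action of a kernel (or matrix) on functions, `(A g)(i) = ∑ j, A i j * g j`. -/
noncomputable def kernelApply {E : Type*} (A : E → E → ℝ) (g : E → ℝ) (i : E) : ℝ :=
  ∑' j, A i j * g j

/-- The mean `π(g)`. -/
noncomputable def mean {E : Type*} (π : E → ℝ) (g : E → ℝ) : ℝ := ∑' i, π i * g i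

/-- Membership in the real space `L²(π)`. -/
def MemL2 {E : Type*} (π : E → ℝ) (g : E → ℝ) : Prop := Summable fun i => π i * g i ^ 2

/-- The inner product of `L²(π)`. -/
noncomputable def innerL2 {E : Type*} (π : E → ℝ) (g h : E → ℝ) : ℝ := ∑' i, π i * (g i * h i)

/-- The domain of the generator of the semigroup `P` in `L²(π)`: those `g` in `L²(π)` for which
`(P_t g - g) / t` converges in `L²(π)` as `t ↓ 0`. -/
def MemGeneratorDomain {E : Type*} (P : ℝ → E → E → ℝ) (π : E → ℝ) (g : E → ℝ) : Prop :=
  MemL2 π g ∧ ∃ ψ : E → ℝ, MemL2 π ψ ∧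
    Tendsto (fun t : ℝ => mean π fun i => ((kernelApply (P t) g i - g i) / t - ψ i) ^ 2)
      (𝓝[>] 0) (𝓝 0)

/-- The spectral gap `inf {(-Q g, g) : π(g) = 0, ‖g‖ = 1}`, where `g` runs over the domain of the
generator in `L²(π)`. It is an extended real, so that the infimum over the empty set
(a one-point state space) is `⊤`. -/
noncomputable def spectralGap {E : Type*} (Q : E → E → ℝ) (P : ℝ → E → E → ℝ) (π : E → ℝ) :
    EReal :=
  sInf {x : EReal | ∃ g : E → ℝ, MemGeneratorDomain P π g ∧ mean π g = 0 ∧ innerL2 π g g = 1 ∧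
    x = ((innerL2 π (fun i => -kernelApply Q g i) g : ℝ) : EReal)}

/-- The `f`-norm `sup {|μ(g)| : |g| ≤ f}` of a signed measure `μ` on `E`. -/
noncomputable def fNorm {E : Type*} (f : E → ℝ) (μ : E → ℝ) : ENNReal :=
  ⨆ (g : E → ℝ) (_ : ∀ j, |g j| ≤ f j), ENNReal.ofReal |∑' j, μ j * g j|

/-- `‖P_t(i,·) - π‖_f ≤ C(i) e^{-ε t}` for all `i` and all `t ≥ 0`. -/
def FErgodicBound {E : Type*} (P : ℝ → E → E → ℝ) (π f : E → ℝ) (ε : ℝ) (C : E → ℝ) : Prop :=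
  ∀ i, ∀ t : ℝ, 0 ≤ t →
    fNorm f (fun j => P t i j - π j) ≤ ENNReal.ofReal (C i * Real.exp (-ε * t))

/-- Rates `ε > 0` of exponential `f`-ergodicity. -/
def fErgodicRates {E : Type*} (P : ℝ → E → E → ℝ) (π f : E → ℝ) : Set ℝ :=
  {ε | 0 < ε ∧ ∃ C : E → ℝ, (∀ i, 0 < C i) ∧ FErgodicBound P π f ε C}

/-- Exponential `f`-ergodicity. -/
def ExponentiallyFErgodic {E : Type*} (P : ℝ → E → E → ℝ) (π f : E → ℝ) : Prop :=
  ∃ ε : ℝ, ε ∈ fErgodicRates P π f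

/-- The exponential convergence rate `ε_max` of `f`-ergodicity, the supremum of all rates. -/
noncomputable def fErgodicRate {E : Type*} (P : ℝ → E → E → ℝ) (π f : E → ℝ) : EReal :=
  sSup ((fun ε : ℝ => (ε : EReal)) '' fErgodicRates P π f)

/-! For bounded `h` of mean zero, differentiating the squared norm of `P_t h` and applying the
definition of the gap should give decay like `e^{-2εt}` for every `ε ≤ gap`. No reversibility is
needed, since only the quadratic form `(-Qg, g)` enters. But `P_t h` need not lie in the generator
domain, so it is replaced by `g_t = ∫_t^{t+a} P_s h ds`. This lies in the domain, and `Q g_t =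
P_{t+a} h - P_t h` is also its time derivative (`kernelApply_Q_orbitIntegral`). Hence `d/dt ‖g_t‖² =
2 (Q g_t, g_t) ≤ -2ε ‖g_t‖²`; dividing by `a²` and letting `a ↓ 0` gives the decay of `P_t h`
(`mean_sq_kernelApply_le`).

Because `π` charges every point, `L²` decay gives pointwise decay: on mean-zero functions,
evaluation at `i` has squared norm at most `1/π_i - 1` (`sq_le_mean_sq`). This is applied to
centred, finitely supported truncations of a test function `|g| ≤ f`, whose variance is at most
`π(f²)`. The bound does not depend on the truncation. -/

/-! ### Weighted sums over the state space. -/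

section WeightedSums

variable {E : Type*}

/-- A summable family multiplied by a bounded one is summable. -/
theorem Summable.mul_bounded {c h : E → ℝ} {M : ℝ} (hc : Summable fun i => |c i|)
    (hh : ∀ i, |h i| ≤ M) : Summable fun i => c i * h i :=
  Summable.of_norm_bounded (hc.mul_right M) fun i => by
    rw [Real.norm_eq_abs, abs_mul]
    exact mul_le_mul_of_nonneg_left (hh i) (abs_nonneg _)

theorem abs_tsum_mul_le {c h : E → ℝ} {S M : ℝ} (hc0 : ∀ i, 0 ≤ c i) (hc : HasSum c S)
    (hh : ∀ i, |h i| ≤ M) : |∑' i, c i * h i| ≤ S * M := by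
  have := tsum_of_norm_bounded (f := fun i => c i * h i) (hc.mul_right M) fun i => by
    rw [Real.norm_eq_abs, abs_mul, abs_of_nonneg (hc0 i)]
    exact mul_le_mul_of_nonneg_left (hh i) (hc0 i)
  simpa using this

/-- Fubini for a nonnegative summable family pushed through a stochastic kernel. -/
theorem tsum_mul_kernelApply {a c h : E → ℝ} {K : E → E → ℝ} {M : ℝ} (ha0 : ∀ k, 0 ≤ a k)
    (ha : Summable a) (hK0 : ∀ k j, 0 ≤ K k j) (hK : ∀ k, HasSum (K k) 1)
    (hc : ∀ j, HasSum (fun k => a k * K k j) (c j)) (hh : ∀ i, |h i| ≤ M) :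
    ∑' k, a k * kernelApply K h k = ∑' j, c j * h j := by
  have hp : Summable fun x : E × E => a x.1 * K x.1 x.2 := by
    have h0 : (0 : E × E → ℝ) ≤ fun x => a x.1 * K x.1 x.2 :=
      fun x => mul_nonneg (ha0 x.1) (hK0 x.1 x.2)
    refine (summable_prod_of_nonneg h0).2 ⟨fun k => (hK k).summable.mul_left (a k), ?_⟩
    simpa only [tsum_mul_left, (hK _).tsum_eq, mul_one] using ha
  have hs : Summable (Function.uncurry fun k j => a k * K k j * h j) :=
    Summable.mul_bounded (c := fun x : E × E => a x.1 * K x.1 x.2) (h := fun x => h x.2)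
      hp.abs fun x => hh x.2
  calc ∑' k, a k * kernelApply K h k = ∑' k, ∑' j, a k * K k j * h j := by
        simp_rw [kernelApply, ← tsum_mul_left, mul_assoc]
    _ = ∑' j, ∑' k, a k * K k j * h j := hs.tsum_comm.symm
    _ = ∑' j, c j * h j := by simp_rw [tsum_mul_right, (hc _).tsum_eq]

/-- Exchange of a weighted sum with the integral of uniformly bounded continuous functions. -/
theorem tsum_mul_intervalIntegral [Countable E] {c : E → ℝ} {u : ℝ → E → ℝ} {M : ℝ}
    (hc : Summable fun k => |c k|) (hu : ∀ k, Continuous fun s => u s k)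
    (hM : ∀ s k, |u s k| ≤ M) (x y : ℝ) :
    ∑' k, c k * ∫ s in x..y, u s k = ∫ s in x..y, ∑' k, c k * u s k := by
  have key : HasSum (fun k => ∫ s in x..y, c k * u s k) (∫ s in x..y, ∑' k, c k * u s k) := by
    apply intervalIntegral.hasSum_integral_of_dominated_convergence (fun k _ => |c k| * M)
    · exact fun k => ((hu k).const_mul (c k)).aestronglyMeasurable
    · refine fun k => Filter.Eventually.of_forall fun s _ => ?_
      rw [Real.norm_eq_abs, abs_mul]
      exact mul_le_mul_of_nonneg_left (hM s k) (abs_nonneg _)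
    · exact Filter.Eventually.of_forall fun s _ => hc.mul_right M
    · exact intervalIntegrable_const
    · exact Filter.Eventually.of_forall fun s _ => (Summable.mul_bounded hc (hM s)).hasSum
  rw [← key.tsum_eq]
  simp_rw [intervalIntegral.integral_const_mul]

/-- Bounded convergence for the mean of squares. -/
theorem tendsto_mean_sq {α : Type*} {l : Filter α} [l.IsCountablyGenerated] {π : E → ℝ}
    {F : α → E → ℝ} {v : E → ℝ} {M : ℝ} (hπ0 : ∀ i, 0 ≤ π i) (hπ : Summable π)
    (hF : ∀ i, Tendsto (fun s => F s i) l (𝓝 (v i))) (hM : ∀ᶠ s in l, ∀ i, |F s i| ≤ M) :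
    Tendsto (fun s => mean π fun i => F s i ^ 2) l (𝓝 (mean π fun i => v i ^ 2)) := by
  refine tendsto_tsum_of_dominated_convergence (hπ.mul_right (M ^ 2))
    (fun i => ((hF i).pow 2).const_mul (π i)) ?_
  filter_upwards [hM] with s hs i
  rw [Real.norm_eq_abs, abs_mul, abs_of_nonneg (hπ0 i), abs_pow]
  exact mul_le_mul_of_nonneg_left (pow_le_pow_left₀ (abs_nonneg _) (hs i) 2) (hπ0 i)

theorem memL2_of_bounded {π g : E → ℝ} {M : ℝ} (hπ : Summable π)
    (hg : ∀ i, |g i| ≤ M) : MemL2 π g :=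
  Summable.mul_bounded (M := M ^ 2) hπ.abs fun i => by
    rw [abs_pow]; exact pow_le_pow_left₀ (abs_nonneg _) (hg i) 2

/-- A mean-zero function is bounded at each point by its `L²` norm. -/
theorem sq_le_mean_sq {π v : E → ℝ} (hpos : ∀ i, 0 < π i) (hsum : HasSum π 1)
    {M : ℝ} (hv : ∀ i, |v i| ≤ M) (h0 : mean π v = 0) (i : E) :
    v i ^ 2 ≤ (1 / π i - 1) * mean π fun j => v j ^ 2 := by
  classical
  have hs1 : HasSum (fun j => π j * v j) 0 := by
    rw [← h0]; exact (Summable.mul_bounded hsum.summable.abs hv).hasSum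
  have hs2 : HasSum (fun j => π j * v j ^ 2) (mean π fun j => v j ^ 2) :=
    (memL2_of_bounded hsum.summable hv).hasSum
  set S := mean π fun j => v j ^ 2
  -- The quadratic is `‖v + x (1 - 1_i/π_i)‖²` in `L²(π)`, expanded using `π(v) = 0`; its
  -- discriminant gives Cauchy–Schwarz against `1_i/π_i - 1`.
  have hq : ∀ x : ℝ, 0 ≤ (1 / π i - 1) * (x * x) + (-2 * v i) * x + S := fun x => by
    have h := ((hs2.add (hs1.mul_left (2 * x))).add (hsum.mul_left (x ^ 2))).add
      (hasSum_ite_eq i (-2 * x * (v i + x) + x ^ 2 / π i))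
    have hp := (hpos i).ne'
    have h' := h.nonneg fun j => by
      have : π j * v j ^ 2 + 2 * x * (π j * v j) + x ^ 2 * π j +
          (if j = i then -2 * x * (v i + x) + x ^ 2 / π i else 0) =
          π j * (v j + x - if j = i then x / π i else 0) ^ 2 := by
        split_ifs with hj
        · subst hj; field_simp; ring
        · ring
      rw [this]
      exact mul_nonneg (hpos j).le (sq_nonneg _)
    have e : S + 2 * x * 0 + x ^ 2 * 1 + (-2 * x * (v i + x) + x ^ 2 / π i) =
        (1 / π i - 1) * (x * x) + (-2 * v i) * x + S := by ring
    rwa [e] at h'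
  have hd := discrim_le_zero hq
  rw [discrim] at hd
  linarith

end WeightedSums

/-! ### The semigroup and its generator on bounded functions. -/

section Semigroup

variable {E : Type*} {Q : E → E → ℝ} {P : ℝ → E → E → ℝ} {π h : E → ℝ} {M : ℝ}

theorem kernelApply_const_mul (A : E → E → ℝ) (c : ℝ) (g : E → ℝ) (i : E) :
    kernelApply A (fun j => c * g j) i = c * kernelApply A g i := by
  simp only [kernelApply, ← tsum_mul_left]
  exact tsum_congr fun j => by ring

namespace IsMarkovSemigroup

theorem summable_abs (hP : IsMarkovSemigroup Q P) {t : ℝ} (ht : 0 ≤ t) (i : E) :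
    Summable fun j => |P t i j| := (hP.row_sum t ht i).summable.abs

theorem abs_kernelApply_le (hP : IsMarkovSemigroup Q P) {t : ℝ} (ht : 0 ≤ t)
    (hh : ∀ i, |h i| ≤ M) (i : E) : |kernelApply (P t) h i| ≤ M := by
  simpa only [one_mul] using! abs_tsum_mul_le (hP.nonneg t ht i) (hP.row_sum t ht i) hh

theorem kernelApply_zero (hP : IsMarkovSemigroup Q P) (h : E → ℝ) (i : E) :
    kernelApply (P 0) h i = h i := by
  rw [kernelApply, tsum_eq_single i, hP.zero_diag, one_mul]
  intro j hj
  rw [hP.zero_offDiag i j hj.symm, zero_mul]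

theorem kernelApply_kernelApply (hP : IsMarkovSemigroup Q P) {s t : ℝ} (hs : 0 ≤ s) (ht : 0 ≤ t)
    (hh : ∀ i, |h i| ≤ M) (i : E) :
    kernelApply (P s) (kernelApply (P t) h) i = kernelApply (P (s + t)) h i :=
  tsum_mul_kernelApply (hP.nonneg s hs i) (hP.row_sum s hs i).summable (hP.nonneg t ht)
    (hP.row_sum t ht) (hP.chapman_kolmogorov s t hs ht i) hh

theorem mean_kernelApply (hP : IsMarkovSemigroup Q P) (hπ : IsStationaryDistribution P π) {t : ℝ}
    (ht : 0 ≤ t) (hh : ∀ i, |h i| ≤ M) : mean π (kernelApply (P t) h) = mean π h :=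
  tsum_mul_kernelApply (fun k => (hπ.pos k).le) hπ.sum_one.summable (hP.nonneg t ht)
    (hP.row_sum t ht) (hπ.stationary t ht) hh

/-- Only the mass that has left `i` contributes. The bound depends on `h` only through `M`, so it
applies equally to `P_b h` and yields continuity at all times. -/
theorem abs_kernelApply_sub_le (hP : IsMarkovSemigroup Q P) {t : ℝ} (ht : 0 ≤ t)
    (hh : ∀ i, |h i| ≤ M) (i : E) : |kernelApply (P t) h i - h i| ≤ 2 * M * (1 - P t i i) := by
  classical
  have h1 : HasSum (fun j => P t i j * (h j - h i)) (kernelApply (P t) h i - h i) := by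
    have := (Summable.mul_bounded (hP.summable_abs ht i) hh).hasSum.sub
      ((hP.row_sum t ht i).mul_right (h i))
    rw [one_mul] at this
    simp only [mul_sub]
    exact this
  -- The majorant may drop the diagonal entry, because `h j - h i` vanishes there.
  have h2 : HasSum (fun j => (P t i j - if j = i then P t i i else 0) * (2 * M))
      ((1 - P t i i) * (2 * M)) :=
    ((hP.row_sum t ht i).sub (hasSum_ite_eq i (P t i i))).mul_right (2 * M)
  rw [mul_comm, ← h1.tsum_eq, ← Real.norm_eq_abs]
  refine tsum_of_norm_bounded h2 fun j => ?_
  split_ifs with hj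
  · simp [hj]
  · rw [Real.norm_eq_abs, abs_mul, abs_of_nonneg (hP.nonneg t ht i j), sub_zero]
    refine mul_le_mul_of_nonneg_left ?_ (hP.nonneg t ht i j)
    linarith [abs_sub (h j) (h i), hh i, hh j]

theorem tendsto_diag (hP : IsMarkovSemigroup Q P) (i : E) :
    Tendsto (fun t => P t i i) (𝓝[≥] 0) (𝓝 1) := by
  have := (hP.deriv_zero i i).continuousWithinAt
  rw [ContinuousWithinAt, hP.zero_diag] at this
  exact this

/-- For bounded `h`, `t ↦ P_t h (i)` extended by `h i` to negative times is continuous. -/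
theorem continuous_kernelApply (hP : IsMarkovSemigroup Q P) (hh : ∀ i, |h i| ≤ M) (i : E) :
    Continuous fun t : ℝ => kernelApply (P (max t 0)) h i := by
  have key : ∀ s t : ℝ, |kernelApply (P (max s 0)) h i - kernelApply (P (max t 0)) h i| ≤
      2 * M * (1 - P |max s 0 - max t 0| i i) := by
    -- Write `P_{a+b} h - P_b h = (P_a - I) P_b h`.
    have aux : ∀ a b : ℝ, 0 ≤ a → 0 ≤ b →
        |kernelApply (P (a + b)) h i - kernelApply (P b) h i| ≤ 2 * M * (1 - P a i i) := by
      intro a b ha hb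
      rw [← hP.kernelApply_kernelApply ha hb hh]
      exact hP.abs_kernelApply_sub_le ha (hP.abs_kernelApply_le hb hh) i
    intro s t
    rcases le_total (max t 0) (max s 0) with hst | hst
    · rw [abs_of_nonneg (sub_nonneg.2 hst)]
      simpa using aux (max s 0 - max t 0) (max t 0) (sub_nonneg.2 hst) (le_max_right _ _)
    · rw [abs_sub_comm, abs_sub_comm (max s 0), abs_of_nonneg (sub_nonneg.2 hst)]
      simpa using aux (max t 0 - max s 0) (max s 0) (sub_nonneg.2 hst) (le_max_right _ _)
  rw [continuous_iff_continuousAt]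
  intro t
  rw [ContinuousAt, tendsto_iff_dist_tendsto_zero]
  refine squeeze_zero (fun _ => dist_nonneg) (fun s => key s t) ?_
  have h1 : Tendsto (fun s : ℝ => |max s 0 - max t 0|) (𝓝 t) (𝓝[≥] 0) := by
    refine tendsto_nhdsWithin_iff.2 ⟨?_, Filter.Eventually.of_forall fun s => Set.mem_Ici.2 (abs_nonneg _)⟩
    have : Continuous fun s : ℝ => |max s 0 - max t 0| := by fun_prop
    simpa using this.tendsto t
  have h2 := (((hP.tendsto_diag i).comp h1).const_sub 1).const_mul (2 * M)
  simpa using h2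

/-- On bounded functions the pointwise generator of the semigroup is `Q` (conservativity). -/
theorem tendsto_kernelApply_sub_div (hQ : IsQMatrix Q) (hP : IsMarkovSemigroup Q P)
    (hh : ∀ i, |h i| ≤ M) (i : E) :
    Tendsto (fun t => (kernelApply (P t) h i - h i) / t) (𝓝[>] 0) (𝓝 (kernelApply Q h i)) := by
  classical
  -- the difference quotient of row `i`, with row sum zero
  let a : ℝ → E → ℝ := fun t j => (P t i j - P 0 i j) / t
  have ha : ∀ j, Tendsto (fun t => a t j) (𝓝[>] 0) (𝓝 (Q i j)) := fun j => by
    have := (hasDerivWithinAt_iff_tendsto_slope.1 (hP.deriv_zero i j))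
    rw [show Set.Ici (0 : ℝ) \ {0} = Set.Ioi 0 by ext; simp [lt_iff_le_and_ne, eq_comm]] at this
    refine this.congr fun t => ?_
    simp [a, slope_def_field]
  have ha0 : ∀ t, 0 < t → HasSum (a t) 0 := fun t ht => by
    have := ((hP.row_sum t ht.le i).sub (hP.row_sum 0 le_rfl i)).div_const t
    simpa using this
  have hoff : ∀ t, 0 < t → ∀ j, i ≠ j → 0 ≤ a t j := fun t ht j hj => by
    simp only [a, hP.zero_offDiag i j hj, sub_zero]
    exact div_nonneg (hP.nonneg t ht.le i j) ht.le
  have hM : 0 ≤ M := (abs_nonneg _).trans (hh i)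
  -- Zero row sum turns the mass outside `F` into minus the sum over `F`. Tails are thus controlled
  -- by finite sums, which converge as `t ↓ 0`; this is where conservativity enters.
  have split : ∀ b : E → ℝ, HasSum b 0 → (∀ j, i ≠ j → 0 ≤ b j) → ∀ F : Finset E, i ∈ F →
      |∑' j, b j * h j - ∑ j ∈ F, b j * h j| ≤ -(∑ j ∈ F, b j) * M := by
    intro b hb hb0 F hF
    have hs := Summable.mul_bounded hb.summable.abs hh
    have h1 : HasSum (fun j : {j // j ∉ F} => b j) (-∑ j ∈ F, b j) := by
      rw [← zero_sub]
      exact (F.hasSum_compl_iff).2 (by simpa using hb)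
    have h2 : ∑' j, b j * h j - ∑ j ∈ F, b j * h j = ∑' j : {j // j ∉ F}, b j * h j := by
      rw [← hs.sum_add_tsum_subtype_compl F]; ring
    rw [h2]
    exact abs_tsum_mul_le (c := fun j : {j // j ∉ F} => b j) (h := fun j => h j)
      (fun j => hb0 j fun e => j.2 (e ▸ hF)) h1 fun j => hh j
  have eq : ∀ t, 0 < t → (kernelApply (P t) h i - h i) / t = ∑' j, a t j * h j := fun t ht => by
    have hs : HasSum (fun j => (P t i j * h j - P 0 i j * h j) / t)
        ((kernelApply (P t) h i - kernelApply (P 0) h i) / t) :=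
      ((Summable.mul_bounded (hP.summable_abs ht.le i) hh).hasSum.sub
        (Summable.mul_bounded (hP.summable_abs le_rfl i) hh).hasSum).div_const t
    rw [hP.kernelApply_zero] at hs
    rw [← hs.tsum_eq]
    exact tsum_congr fun j => by ring
  rw [Metric.tendsto_nhds]
  intro η hη
  -- Three errors of `η / 4` each: the tail of `a t`, the tail of `Q i`, and the difference of the
  -- sums over `F`.
  obtain ⟨F, hF, hFη⟩ : ∃ F : Finset E, i ∈ F ∧ -(∑ j ∈ F, Q i j) * M < η / 4 := by
    have : Tendsto (fun F : Finset E => -(∑ j ∈ F, Q i j) * M) atTop (𝓝 0) := by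
      have := (Filter.Tendsto.neg (hQ.row_sum i)).mul_const M
      simpa only [neg_zero, zero_mul, SummationFilter.unconditional_filter] using this
    obtain ⟨F, h1, h2⟩ := ((this.eventually (gt_mem_nhds (by positivity : 0 < η / 4))).and
      (eventually_ge_atTop {i})).exists
    exact ⟨F, by simpa using h2, h1⟩
  have l1 : Tendsto (fun t => -(∑ j ∈ F, a t j) * M) (𝓝[>] 0) (𝓝 (-(∑ j ∈ F, Q i j) * M)) :=
    (tendsto_finsetSum F fun j _ => ha j).neg.mul_const M
  have l2 : Tendsto (fun t => ∑ j ∈ F, a t j * h j) (𝓝[>] 0) (𝓝 (∑ j ∈ F, Q i j * h j)) :=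
    tendsto_finsetSum F fun j _ => (ha j).mul_const _
  filter_upwards [l1.eventually (gt_mem_nhds hFη), Metric.tendsto_nhds.1 l2 (η / 4) (by positivity),
    self_mem_nhdsWithin] with t h1 h2 ht
  have h3 := split (a t) (ha0 t ht) (hoff t ht) F hF
  have h4 := split (Q i) (hQ.row_sum i) (hQ.offDiag_nonneg i) F hF
  rw [eq t ht, Real.dist_eq]
  rw [Real.dist_eq] at h2
  rw [kernelApply]
  rw [abs_lt] at *
  rw [abs_le] at h3 h4
  constructor <;> linarith [h3.1, h3.2, h4.1, h4.2, h2.1, h2.2]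

end IsMarkovSemigroup

end Semigroup

/-! ### Trajectories and their integrals over a window. -/

/-- The trajectory `t ↦ P_t h`, frozen at `h` for negative times. -/
noncomputable def orbit {E : Type*} (P : ℝ → E → E → ℝ) (h : E → ℝ) (t : ℝ) (i : E) : ℝ :=
  kernelApply (P (max t 0)) h i

/-- The trajectory integrated over the window `[t, t + a]`. -/
noncomputable def orbitIntegral {E : Type*} (P : ℝ → E → E → ℝ) (h : E → ℝ) (a t : ℝ) (i : E) :
    ℝ := ∫ s in t..(t + a), orbit P h s i

section Orbit

variable {E : Type*} {Q : E → E → ℝ} {P : ℝ → E → E → ℝ} {π h : E → ℝ} {M : ℝ}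

namespace IsMarkovSemigroup

theorem continuous_orbit (hP : IsMarkovSemigroup Q P) (hh : ∀ i, |h i| ≤ M) (i : E) :
    Continuous fun t => orbit P h t i := hP.continuous_kernelApply hh i

theorem abs_orbit_le (hP : IsMarkovSemigroup Q P) (hh : ∀ i, |h i| ≤ M) (t : ℝ) (i : E) :
    |orbit P h t i| ≤ M := hP.abs_kernelApply_le (le_max_right _ _) hh i

theorem kernelApply_orbit (hP : IsMarkovSemigroup Q P) (hh : ∀ i, |h i| ≤ M) {s t : ℝ}
    (hs : 0 ≤ s) (ht : 0 ≤ t) (i : E) :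
    kernelApply (P s) (orbit P h t) i = orbit P h (s + t) i := by
  have := hP.kernelApply_kernelApply hs (le_max_right t 0) hh i
  rw [show orbit P h t = kernelApply (P (max t 0)) h from rfl, this, orbit, max_eq_left ht,
    max_eq_left (add_nonneg hs ht)]

/-- Freezing the trajectory at negative times keeps it continuous on the whole line, so the
fundamental theorem of calculus gives a two-sided derivative even at `0`. -/
theorem hasDerivAt_orbitIntegral (hP : IsMarkovSemigroup Q P) (hh : ∀ i, |h i| ≤ M) (a t : ℝ)
    (i : E) : HasDerivAt (fun t => orbitIntegral P h a t i)
      (orbit P h (t + a) i - orbit P h t i) t := by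
  have hc := hP.continuous_orbit hh i
  have hF : ∀ x, HasDerivAt (fun y => ∫ s in (0 : ℝ)..y, orbit P h s i) (orbit P h x i) x :=
    fun x => (hc.integral_hasStrictDerivAt 0 x).hasDerivAt
  have := ((hF (t + a)).comp_add_const t a).sub (hF t)
  refine this.congr_of_eventuallyEq (Filter.Eventually.of_forall fun x => ?_)
  exact (intervalIntegral.integral_interval_sub_left (hc.intervalIntegrable _ _)
    (hc.intervalIntegrable _ _)).symm

theorem abs_orbitIntegral_le (hP : IsMarkovSemigroup Q P) (hh : ∀ i, |h i| ≤ M) {a : ℝ}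
    (ha : 0 ≤ a) (t : ℝ) (i : E) : |orbitIntegral P h a t i| ≤ M * a := by
  have := intervalIntegral.norm_integral_le_of_norm_le_const (a := t) (b := t + a)
    (f := fun s => orbit P h s i) (C := M) fun s _ => hP.abs_orbit_le hh s i
  rwa [add_sub_cancel_left, abs_of_nonneg ha] at this

theorem abs_orbitIntegral_sub_le (hP : IsMarkovSemigroup Q P) (hh : ∀ i, |h i| ≤ M) (a s t : ℝ)
    (i : E) : |orbitIntegral P h a t i - orbitIntegral P h a s i| ≤ 2 * M * |t - s| :=
  convex_univ.norm_image_sub_le_of_norm_hasDerivWithin_le (f := fun t => orbitIntegral P h a t i)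
    (fun x _ => (hP.hasDerivAt_orbitIntegral hh a x i).hasDerivWithinAt)
    (fun x _ => by
      rw [Real.norm_eq_abs]
      linarith [abs_sub (orbit P h (x + a) i) (orbit P h x i), hP.abs_orbit_le hh (x + a) i,
        hP.abs_orbit_le hh x i])
    (Set.mem_univ s) (Set.mem_univ t)

theorem kernelApply_orbitIntegral [Countable E] (hP : IsMarkovSemigroup Q P)
    (hh : ∀ i, |h i| ≤ M) {a s t : ℝ} (ha : 0 ≤ a) (hs : 0 ≤ s) (ht : 0 ≤ t) (i : E) :
    kernelApply (P s) (orbitIntegral P h a t) i = orbitIntegral P h a (s + t) i := by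
  calc kernelApply (P s) (orbitIntegral P h a t) i
      = ∫ r in t..(t + a), kernelApply (P s) (orbit P h r) i :=
        tsum_mul_intervalIntegral (hP.summable_abs hs i) (hP.continuous_orbit hh)
          (hP.abs_orbit_le hh) _ _
    _ = ∫ r in t..(t + a), orbit P h (s + r) i := by
        refine intervalIntegral.integral_congr fun r hr => ?_
        rw [Set.uIcc_of_le (by linarith)] at hr
        exact hP.kernelApply_orbit hh hs (ht.trans hr.1) i
    _ = orbitIntegral P h a (s + t) i := by
        rw [intervalIntegral.integral_comp_add_left (fun r => orbit P h r i), ← add_assoc]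
        rfl

theorem mean_orbitIntegral [Countable E] (hP : IsMarkovSemigroup Q P)
    (hπ : IsStationaryDistribution P π) (hh : ∀ i, |h i| ≤ M) (h0 : mean π h = 0) (a t : ℝ) :
    mean π (orbitIntegral P h a t) = 0 := by
  calc mean π (orbitIntegral P h a t) = ∫ r in t..(t + a), mean π (orbit P h r) :=
        tsum_mul_intervalIntegral hπ.sum_one.summable.abs (hP.continuous_orbit hh)
          (hP.abs_orbit_le hh) _ _
    _ = ∫ r in t..(t + a), 0 :=
        intervalIntegral.integral_congr fun r _ =>
          (hP.mean_kernelApply hπ (le_max_right r 0) hh).trans h0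
    _ = 0 := by simp

theorem tendsto_orbitIntegral_sub_div (hP : IsMarkovSemigroup Q P) (hh : ∀ i, |h i| ≤ M)
    (a t : ℝ) (i : E) :
    Tendsto (fun s => (orbitIntegral P h a (s + t) i - orbitIntegral P h a t i) / s) (𝓝[>] 0)
      (𝓝 (orbit P h (t + a) i - orbit P h t i)) := by
  have := (hP.hasDerivAt_orbitIntegral hh a t i).tendsto_slope_zero_right
  refine this.congr fun s => ?_
  rw [smul_eq_mul, add_comm t s, div_eq_inv_mul]

/-- The pointwise limit of `(P_s g - g)/s` is computed in two ways: as the action of `Q` on a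
bounded function, and as the time derivative of the integrated trajectory. -/
theorem kernelApply_Q_orbitIntegral [Countable E] (hQ : IsQMatrix Q) (hP : IsMarkovSemigroup Q P)
    (hh : ∀ i, |h i| ≤ M) {a t : ℝ} (ha : 0 ≤ a) (ht : 0 ≤ t) (i : E) :
    kernelApply Q (orbitIntegral P h a t) i = orbit P h (t + a) i - orbit P h t i := by
  refine tendsto_nhds_unique
    (hP.tendsto_kernelApply_sub_div hQ (hP.abs_orbitIntegral_le hh ha t) i) ?_
  refine (hP.tendsto_orbitIntegral_sub_div hh a t i).congr' ?_
  filter_upwards [self_mem_nhdsWithin] with s hs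
  rw [hP.kernelApply_orbitIntegral hh ha (le_of_lt hs) ht]

/-- Integrated trajectories of bounded functions lie in the domain of the `L²` generator. -/
theorem memGeneratorDomain_orbitIntegral [Countable E] (hP : IsMarkovSemigroup Q P)
    (hπ : IsStationaryDistribution P π) (hh : ∀ i, |h i| ≤ M) {a t : ℝ} (ha : 0 ≤ a)
    (ht : 0 ≤ t) : MemGeneratorDomain P π (orbitIntegral P h a t) := by
  have hsum := hπ.sum_one.summable
  have hψ : ∀ i, |orbit P h (t + a) i - orbit P h t i| ≤ 2 * M := fun i => by
    linarith [abs_sub (orbit P h (t + a) i) (orbit P h t i), hP.abs_orbit_le hh (t + a) i,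
      hP.abs_orbit_le hh t i]
  refine ⟨memL2_of_bounded hsum (hP.abs_orbitIntegral_le hh ha t),
    fun i => orbit P h (t + a) i - orbit P h t i, memL2_of_bounded hsum hψ, ?_⟩
  -- The bound `4 * M` is `2 * M` for the difference quotient, by the Lipschitz estimate, plus `2 *
  -- M` for its limit.
  have hlim := tendsto_mean_sq (π := π) (l := 𝓝[>] (0 : ℝ)) (v := fun _ => 0) (M := 4 * M)
    (F := fun s i => (kernelApply (P s) (orbitIntegral P h a t) i - orbitIntegral P h a t i) / s -
      (orbit P h (t + a) i - orbit P h t i))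
    (fun i => (hπ.pos i).le) hsum ?_ ?_
  · simpa [mean] using hlim
  · intro i
    have := (hP.tendsto_orbitIntegral_sub_div hh a t i).sub_const
      (orbit P h (t + a) i - orbit P h t i)
    rw [sub_self] at this
    refine this.congr' ?_
    filter_upwards [self_mem_nhdsWithin] with s hs
    rw [hP.kernelApply_orbitIntegral hh ha (le_of_lt hs) ht]
  · filter_upwards [self_mem_nhdsWithin] with s hs i
    have hs : 0 < s := hs
    rw [hP.kernelApply_orbitIntegral hh ha hs.le ht]
    have h1 : |(orbitIntegral P h a (s + t) i - orbitIntegral P h a t i) / s| ≤ 2 * M := by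
      rw [abs_div, abs_of_pos hs, div_le_iff₀ hs]
      simpa [abs_of_pos hs] using hP.abs_orbitIntegral_sub_le hh a t (s + t) i
    linarith [abs_sub ((orbitIntegral P h a (s + t) i - orbitIntegral P h a t i) / s)
      (orbit P h (t + a) i - orbit P h t i), hψ i]

end IsMarkovSemigroup

/-! ### Poincaré inequality and `L²` decay. -/

theorem MemGeneratorDomain.const_mul {g : E → ℝ} (hg : MemGeneratorDomain P π g) (c : ℝ) :
    MemGeneratorDomain P π fun i => c * g i := by
  obtain ⟨h1, ψ, h2, h3⟩ := hg
  have mem : ∀ {u : E → ℝ}, MemL2 π u → MemL2 π fun i => c * u i := fun hu =>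
    (Summable.mul_left (c ^ 2) hu).congr fun i => by ring
  refine ⟨mem h1, fun i => c * ψ i, mem h2, ?_⟩
  have := h3.const_mul (c ^ 2)
  rw [mul_zero] at this
  refine this.congr fun t => ?_
  simp only [mean, kernelApply_const_mul, ← tsum_mul_left]
  exact tsum_congr fun i => by ring

theorem innerL2_const_mul (π g k : E → ℝ) (b c : ℝ) :
    innerL2 π (fun i => b * g i) (fun i => c * k i) = b * c * innerL2 π g k := by
  simp only [innerL2, ← tsum_mul_left]
  exact tsum_congr fun i => by ring

/-- The Poincaré inequality on the generator domain. -/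
theorem spectralGap_poincare {ε : ℝ} (hε : (ε : EReal) ≤ spectralGap Q P π) {g : E → ℝ}
    (hg : MemGeneratorDomain P π g) (h0 : mean π g = 0) (hpos : 0 < innerL2 π g g) :
    ε * innerL2 π g g ≤ innerL2 π (fun i => -kernelApply Q g i) g := by
  set N := innerL2 π g g
  let c : ℝ := (Real.sqrt N)⁻¹
  have hc : c * c = N⁻¹ := by
    rw [← mul_inv, Real.mul_self_sqrt hpos.le]
  have h1 : mean π (fun i => c * g i) = 0 := by
    have : mean π (fun i => c * g i) = c * mean π g := by
      simp only [mean, ← tsum_mul_left]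
      exact tsum_congr fun i => by ring
    rw [this, h0, mul_zero]
  have h2 : innerL2 π (fun i => c * g i) (fun i => c * g i) = 1 := by
    rw [innerL2_const_mul, hc]
    exact inv_mul_cancel₀ hpos.ne'
  have h3 := hε.trans (sInf_le ⟨_, hg.const_mul c, h1, h2, rfl⟩)
  rw [EReal.coe_le_coe_iff] at h3
  simp only [kernelApply_const_mul, ← mul_neg] at h3
  rw [innerL2_const_mul, hc, inv_mul_eq_div, le_div_iff₀ hpos] at h3
  exact h3

/-- Exponential `L²` decay of integrated trajectories. -/
theorem mean_sq_orbitIntegral_le [Countable E] (hQ : IsQMatrix Q) (hP : IsMarkovSemigroup Q P)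
    (hπ : IsStationaryDistribution P π) (hh : ∀ i, |h i| ≤ M) (h0 : mean π h = 0) {ε : ℝ}
    (hε : (ε : EReal) ≤ spectralGap Q P π) {a t : ℝ} (ha : 0 ≤ a) (ht : 0 ≤ t) :
    mean π (fun i => orbitIntegral P h a t i ^ 2) ≤
      Real.exp (-2 * ε * t) * mean π fun i => orbitIntegral P h a 0 i ^ 2 := by
  have hsum := hπ.sum_one.summable
  let φ : ℝ → ℝ := fun t => mean π fun i => orbitIntegral P h a t i ^ 2
  let φ' : ℝ → ℝ := fun t => ∑' i, π i * (2 * orbitIntegral P h a t i *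
    (orbit P h (t + a) i - orbit P h t i))
  have hφ : ∀ t, HasDerivAt φ (φ' t) t := fun t => by
    refine hasDerivAt_tsum (u := fun i => π i * (2 * (M * a) * (2 * M)))
      (g := fun i t => π i * orbitIntegral P h a t i ^ 2)
      (g' := fun i t => π i * (2 * orbitIntegral P h a t i *
        (orbit P h (t + a) i - orbit P h t i))) (y₀ := 0) (hsum.mul_right _) ?_ ?_ ?_ t
    · intro i y
      simpa using ((hP.hasDerivAt_orbitIntegral hh a y i).pow 2).const_mul (π i)
    · intro i y
      rw [Real.norm_eq_abs, abs_mul, abs_of_pos (hπ.pos i), abs_mul, abs_mul, abs_two]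
      have h1 := hP.abs_orbitIntegral_le hh ha y i
      have h2 := abs_sub (orbit P h (y + a) i) (orbit P h y i)
      have h3 := hP.abs_orbit_le hh (y + a) i
      have h4 := hP.abs_orbit_le hh y i
      have h5 := (abs_nonneg _).trans h1
      have := (hπ.pos i).le
      gcongr
      linarith
    · exact memL2_of_bounded hsum (hP.abs_orbitIntegral_le hh ha 0)
  have hle : ∀ t, 0 ≤ t → φ' t ≤ -2 * ε * φ t := fun t ht => by
    have e1 : φ t = innerL2 π (orbitIntegral P h a t) (orbitIntegral P h a t) :=
      tsum_congr fun i => by ring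
    have e2 : φ' t = -2 * innerL2 π (fun i => -kernelApply Q (orbitIntegral P h a t) i)
        (orbitIntegral P h a t) := by
      rw [innerL2, ← tsum_mul_left]
      refine tsum_congr fun i => ?_
      rw [hP.kernelApply_Q_orbitIntegral hQ hh ha ht]
      ring
    have hs := memL2_of_bounded hsum (hP.abs_orbitIntegral_le hh ha t)
    have hnn : ∀ i, 0 ≤ π i * orbitIntegral P h a t i ^ 2 :=
      fun i => mul_nonneg (hπ.pos i).le (sq_nonneg _)
    have hφ0 : 0 ≤ φ t := tsum_nonneg hnn
    -- A function of norm zero cannot be normalised, but it vanishes identically since `π` is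
    -- positive everywhere.
    rcases hφ0.eq_or_lt with hz | hz
    · have hz' : ∀ i, orbitIntegral P h a t i = 0 := fun i => by
        have h1 : π i * orbitIntegral P h a t i ^ 2 ≤ φ t := hs.le_tsum i fun j _ => hnn j
        have h2 := (mul_eq_zero.1 (le_antisymm (hz ▸ h1) (hnn i))).resolve_left (hπ.pos i).ne'
        exact pow_eq_zero_iff two_ne_zero |>.1 h2
      simp [φ', ← hz, hz']
    · have := spectralGap_poincare hε (hP.memGeneratorDomain_orbitIntegral hπ hh ha ht)
        (hP.mean_orbitIntegral hπ hh h0 a t) (e1 ▸ hz)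
      rw [← e1] at this
      rw [e2]
      linarith
  have hψ : ∀ t, HasDerivAt (fun t => φ t * Real.exp (2 * ε * t))
      (φ' t * Real.exp (2 * ε * t) + φ t * (Real.exp (2 * ε * t) * (2 * ε))) t := fun t => by
    have := ((hasDerivAt_id t).const_mul (2 * ε)).exp
    simp only [id, mul_one] at this
    exact (hφ t).mul this
  -- Grönwall's argument; the sign of `ε` plays no role.
  have hanti : AntitoneOn (fun t => φ t * Real.exp (2 * ε * t)) (Set.Ici 0) := by
    refine antitoneOn_of_deriv_nonpos (convex_Ici 0)
      (fun t _ => (hψ t).continuousAt.continuousWithinAt)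
      (fun t _ => (hψ t).differentiableAt.differentiableWithinAt) fun t ht => ?_
    rw [interior_Ici] at ht
    rw [(hψ t).deriv]
    nlinarith [hle t (le_of_lt ht), Real.exp_pos (2 * ε * t)]
  have h1 := hanti (Set.mem_Ici.2 le_rfl) (Set.mem_Ici.2 ht) ht
  simp only [mul_zero, Real.exp_zero, mul_one] at h1
  rw [show -2 * ε * t = -(2 * ε * t) by ring, Real.exp_neg, inv_mul_eq_div,
    le_div_iff₀ (Real.exp_pos _)]
  exact h1

/-- Exponential `L²` decay of the semigroup on bounded functions of mean zero. -/
theorem mean_sq_kernelApply_le [Countable E] (hQ : IsQMatrix Q) (hP : IsMarkovSemigroup Q P)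
    (hπ : IsStationaryDistribution P π) (hh : ∀ i, |h i| ≤ M) (h0 : mean π h = 0) {ε : ℝ}
    (hε : (ε : EReal) ≤ spectralGap Q P π) {t : ℝ} (ht : 0 ≤ t) :
    mean π (fun i => kernelApply (P t) h i ^ 2) ≤
      Real.exp (-2 * ε * t) * mean π fun i => h i ^ 2 := by
  have hsum := hπ.sum_one.summable
  have lim : ∀ t, 0 ≤ t → Tendsto (fun a => mean π fun i => (a⁻¹ * orbitIntegral P h a t i) ^ 2)
      (𝓝[>] 0) (𝓝 (mean π fun i => kernelApply (P t) h i ^ 2)) := fun t ht => by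
    refine tendsto_mean_sq (M := M) (fun i => (hπ.pos i).le) hsum (fun i => ?_) ?_
    · have hc := hP.continuous_orbit hh i
      have := (hc.integral_hasStrictDerivAt t t).hasDerivAt.tendsto_slope_zero_right
      simpa [orbit, max_eq_left ht, orbitIntegral] using this
    · filter_upwards [self_mem_nhdsWithin] with a ha i
      have ha : 0 < a := ha
      rw [abs_mul, abs_of_pos (inv_pos.2 ha), inv_mul_le_iff₀ ha, mul_comm]
      exact hP.abs_orbitIntegral_le hh ha.le t i
  have h00 : (fun i => kernelApply (P 0) h i ^ 2) = fun i => h i ^ 2 := by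
    ext i; rw [hP.kernelApply_zero]
  rw [← h00]
  refine le_of_tendsto_of_tendsto (lim t ht) ((lim 0 le_rfl).const_mul _) ?_
  filter_upwards [self_mem_nhdsWithin] with a ha
  have key := mean_sq_orbitIntegral_le hQ hP hπ hh h0 hε (le_of_lt ha) ht
  have e : ∀ t, mean π (fun i => (a⁻¹ * orbitIntegral P h a t i) ^ 2) =
      (a⁻¹) ^ 2 * mean π fun i => orbitIntegral P h a t i ^ 2 := fun t => by
    simp only [mean, ← tsum_mul_left]
    exact tsum_congr fun i => by ring
  rw [e, e, mul_left_comm]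
  exact mul_le_mul_of_nonneg_left key (sq_nonneg _)

/-! ### From `L²` decay to the `f`-norm. -/

/-- Decay of the signed measure `P_t(i,·) - π` tested against finitely supported functions. -/
theorem abs_sum_sub_mul_le [Countable E] (hQ : IsQMatrix Q) (hP : IsMarkovSemigroup Q P)
    (hπ : IsStationaryDistribution P π) {f g : E → ℝ} (hf2 : MemL2 π f) (hgf : ∀ j, |g j| ≤ f j)
    {ε : ℝ} (hε : (ε : EReal) ≤ spectralGap Q P π) {t : ℝ} (ht : 0 ≤ t) (i : E)
    (F : Finset E) :
    |∑ j ∈ F, (P t i j - π j) * g j| ≤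
      Real.sqrt (mean π fun j => f j ^ 2) * Real.sqrt (1 / π i - 1) * Real.exp (-ε * t) := by
  classical
  have hsum := hπ.sum_one.summable
  -- Truncation to `F` makes the test function bounded, which `f` and `g` need not be.
  let k : E → ℝ := fun j => if j ∈ F then g j else 0
  have hk : ∀ j, |k j| ≤ ∑ l ∈ F, |g l| := fun j => by
    simp only [k]
    split_ifs with hj
    · exact Finset.single_le_sum (f := fun l => |g l|) (fun _ _ => abs_nonneg _) hj
    · simpa using Finset.sum_nonneg fun l _ => abs_nonneg (g l)
  let m : ℝ := mean π k
  let h : E → ℝ := fun j => k j - m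
  have hh : ∀ j, |h j| ≤ ∑ l ∈ F, |g l| + |m| := fun j =>
    (abs_sub _ _).trans (add_le_add (hk j) le_rfl)
  have hks : HasSum (fun j => π j * k j) m := (Summable.mul_bounded hsum.abs hk).hasSum
  have hk2 : Summable fun j => π j * k j ^ 2 := memL2_of_bounded hsum hk
  have h0 : mean π h = 0 := by
    have := hks.sub (hπ.sum_one.mul_right m)
    rw [one_mul, sub_self] at this
    rw [mean, ← this.tsum_eq]
    exact tsum_congr fun j => by ring
  have hvar : mean π (fun j => h j ^ 2) ≤ mean π fun j => f j ^ 2 := by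
    have h1 := ((hk2.hasSum.sub (hks.mul_left (2 * m))).add (hπ.sum_one.mul_left (m ^ 2)))
    have h2 : mean π (fun j => h j ^ 2) = ∑' j, π j * k j ^ 2 - m ^ 2 := by
      rw [show ∑' j, π j * k j ^ 2 - m ^ 2 = ∑' j, π j * k j ^ 2 - 2 * m * m + m ^ 2 * 1 by ring,
        ← h1.tsum_eq]
      exact tsum_congr fun j => by ring
    have h3 : ∑' j, π j * k j ^ 2 ≤ ∑' j, π j * f j ^ 2 := by
      refine hk2.tsum_le_tsum (fun j => ?_) hf2
      refine mul_le_mul_of_nonneg_left (sq_le_sq.2 ?_) (hπ.pos j).le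
      refine le_trans ?_ ((hgf j).trans (le_abs_self _))
      simp only [k]
      split_ifs <;> simp
    rw [h2, mean]
    linarith [sq_nonneg m]
  have hPk : kernelApply (P t) h i = ∑ j ∈ F, (P t i j - π j) * g j := by
    have h1 := (Summable.mul_bounded (hP.summable_abs ht i) hk).hasSum.sub
      ((hP.row_sum t ht i).mul_right m)
    have h2 : kernelApply (P t) h i = ∑' j, P t i j * k j - 1 * m := by
      rw [← h1.tsum_eq]
      exact tsum_congr fun j => by ring
    have fin : ∀ c : E → ℝ, ∑' j, c j * k j = ∑ j ∈ F, c j * g j := fun c => by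
      rw [tsum_eq_sum (s := F) fun j hj => by simp [k, hj]]
      exact Finset.sum_congr rfl fun j hj => by simp [k, hj]
    rw [h2, fin, one_mul, show m = ∑ j ∈ F, π j * g j from fin π, ← Finset.sum_sub_distrib]
    exact Finset.sum_congr rfl fun j _ => by ring
  have hpt := sq_le_mean_sq hπ.pos hπ.sum_one (hP.abs_kernelApply_le ht hh)
    ((hP.mean_kernelApply hπ ht hh).trans h0) i
  have hp1 : π i ≤ 1 := le_hasSum hπ.sum_one i fun j _ => (hπ.pos j).le
  have hc : 0 ≤ 1 / π i - 1 := by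
    rw [sub_nonneg, le_div_iff₀ (hπ.pos i)]; linarith
  have hf0 : 0 ≤ mean π fun j => f j ^ 2 :=
    tsum_nonneg fun j => mul_nonneg (hπ.pos j).le (sq_nonneg _)
  rw [← hPk]
  refine abs_le_of_sq_le_sq ?_ (by positivity)
  rw [mul_pow, mul_pow, Real.sq_sqrt hf0, Real.sq_sqrt hc, ← Real.exp_nat_mul]
  calc kernelApply (P t) h i ^ 2
      ≤ (1 / π i - 1) * (Real.exp (-2 * ε * t) * mean π fun j => f j ^ 2) := by
        refine hpt.trans (mul_le_mul_of_nonneg_left ?_ hc)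
        exact (mean_sq_kernelApply_le hQ hP hπ hh h0 hε ht).trans
          (mul_le_mul_of_nonneg_left hvar (Real.exp_pos _).le)
    _ = _ := by
        rw [show ((2 : ℕ) : ℝ) * (-ε * t) = -2 * ε * t by push_cast; ring]
        ring

/-- `π`-square integrable functions are integrable for `P_t(i,·)`. -/
theorem summable_sub_mul (hP : IsMarkovSemigroup Q P)
    (hπ : IsStationaryDistribution P π) {f g : E → ℝ} (hf : ∀ j, 1 ≤ f j) (hf2 : MemL2 π f)
    (hgf : ∀ j, |g j| ≤ f j) {t : ℝ} (ht : 0 ≤ t) (i : E) :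
    Summable fun j => (P t i j - π j) * g j := by
  refine Summable.of_norm_bounded (hf2.mul_left (1 / π i + 1)) fun j => ?_
  have hp := hπ.pos i
  -- One term of the stationarity equation: `π_i P_t(i,j) ≤ π_j`.
  have h1 : P t i j ≤ π j / π i := by
    rw [le_div_iff₀ hp, mul_comm]
    exact le_hasSum (hπ.stationary t ht j) i fun l _ =>
      mul_nonneg (hπ.pos l).le (hP.nonneg t ht l j)
  have h2 : |P t i j - π j| ≤ (1 / π i + 1) * π j := by
    have h3 := abs_sub (P t i j) (π j)
    rw [abs_of_nonneg (hP.nonneg t ht i j), abs_of_pos (hπ.pos j)] at h3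
    have : (1 / π i + 1) * π j = π j / π i + π j := by ring
    linarith
  rw [Real.norm_eq_abs, abs_mul, ← mul_assoc]
  refine mul_le_mul h2 ?_ (abs_nonneg _) ((abs_nonneg _).trans h2)
  nlinarith [hgf j, hf j]

theorem fErgodicBound_of_le_spectralGap [Countable E] (hQ : IsQMatrix Q)
    (hP : IsMarkovSemigroup Q P) (hπ : IsStationaryDistribution P π) {f : E → ℝ}
    (hf : ∀ j, 1 ≤ f j) (hf2 : MemL2 π f) {ε : ℝ} (hε : (ε : EReal) ≤ spectralGap Q P π) :
    FErgodicBound P π f ε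
      (fun i => Real.sqrt (mean π fun j => f j ^ 2) * Real.sqrt (1 / π i - 1)) := by
  intro i t ht
  refine iSup₂_le fun g hg => ENNReal.ofReal_le_ofReal ?_
  exact le_of_tendsto' (summable_sub_mul hP hπ hf hf2 hg ht i).hasSum.abs fun F =>
    abs_sum_sub_mul_le hQ hP hπ hf2 hg hε ht i F

end Orbit

theorem proposition1 {E : Type*} [Countable E] (Q : E → E → ℝ) (P : ℝ → E → E → ℝ)
    (π f : E → ℝ) (hQ : IsQMatrix Q) (hP : IsMarkovSemigroup Q P)
    (hπ : IsStationaryDistribution P π) (hf : ∀ i, 1 ≤ f i) (hf2 : MemL2 π f)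
    (hgap : 0 < spectralGap Q P π) :
    ExponentiallyFErgodic P π f ∧
      spectralGap Q P π ≤ fErgodicRate P π f ∧
      ∀ ε : ℝ, (ε : EReal) ≤ spectralGap Q P π →
        FErgodicBound P π f ε
          (fun i => Real.sqrt (mean π fun j => f j ^ 2) * Real.sqrt (1 / π i - 1)) := by
  have bound := fun (ε : ℝ) (hε : (ε : EReal) ≤ spectralGap Q P π) =>
    fErgodicBound_of_le_spectralGap hQ hP hπ hf hf2 hε
  have rates : ∀ ε : ℝ, 0 < ε → (ε : EReal) ≤ spectralGap Q P π → ε ∈ fErgodicRates P π f :=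
    -- The constant is increased by `1` to be strictly positive: `1/π_i - 1` is zero on a one-point
    -- space.
    fun ε h0 hε => ⟨h0, _, fun i => add_pos_of_nonneg_of_pos
      (mul_nonneg (Real.sqrt_nonneg _) (Real.sqrt_nonneg _)) one_pos, fun i t ht =>
        (bound ε hε i t ht).trans (ENNReal.ofReal_le_ofReal
          (mul_le_mul_of_nonneg_right (le_add_of_nonneg_right zero_le_one)
            (Real.exp_pos _).le))⟩
  refine ⟨?_, ?_, bound⟩
  · obtain ⟨ε, h0, h1⟩ := EReal.lt_iff_exists_real_btwn.1 hgap
    exact ⟨ε, rates ε (EReal.coe_pos.1 h0) h1.le⟩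
  · refine le_of_forall_lt fun x hx => ?_
    -- Choosing `ε` above `max x 0` makes it a positive rate even when `x` is negative.
    obtain ⟨ε, h0, h1⟩ := EReal.lt_iff_exists_real_btwn.1 (max_lt hx hgap)
    exact (le_max_left x 0).trans_lt h0 |>.trans_le (le_sSup ⟨ε,
      rates ε (EReal.coe_pos.1 ((le_max_right x 0).trans_lt h0)) h1.le, rfl⟩)
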